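/- For real $a,b>0$ and $x\in(-1,1)$ let $$F(a,b;a+b;x)=\sum_{n=0}^{\infty}\frac{(a,n)(b,n)}{(a+b,n)}\frac{x^n}{n!},\qquad (c,n)=c(c+1)\cdots(c+n-1),\quad (c,0)=1,$$ be the zero-balanced Gaussian hypergeometric function, and write $F(x)=F(a,b;a+b;x)$. Let $$B(a,b)=\frac{\Gamma(a)\Gamma(b)}{\Gamma(a+b)},\qquad R(a,b)=-\Psi(a)-\Psi(b)-2\gamma,\qquad \Psi=\frac{\Gamma'}{\Gamma},$$ where $\gamma$ is the Euler–Mascheroni constant. Define the regions $$D_1=\{(a,b): a,b>0,\ ab\le \tfrac29,\ ab-\tfrac29(a+b)\le 0\},\qquad D_3=\{(a,b): a,b>0,\ ab\ge \tfrac29,\ ab-\tfrac29(a+b)\ge 0\},$$ $$D_5=\{(a,b): a,b>0,\ a+b\le 1,\ ab-\tfrac29(a+b)\le 0\},\qquad D_6=\{(a,b): a,b>0,\ a+b\ge 1,\ ab-\tfrac29(a+b)\ge 0\}.$$ **Theorem 2.5.** (1) For $(a,b)\in D_1$ and each $x\in(0,1)$, $$\frac13\le \frac{F\left(\left(\frac{1-x}{1+2x}\right)^3\right)}{(1+2x)F(1-x^3)}\le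 \frac{\sqrt3\,B(a,b)}{6\pi}.$$ (2) For $(a,b)\in D_3$ and each $x\in(0,1)$, $$\frac{\sqrt3\,B(a,b)}{6\pi}\le \frac{F\left(\left(\frac{1-x}{1+2x}\right)^3\right)}{(1+2x)F(1-x^3)}\le \frac13.$$ (3) For $(a,b)\in D_5$ and each $x\in(0,1)$, $$(1+2x)F(1-x^3)\le 3F\left(\left(\tfrac{1-x}{1+2x}\right)^3\right)\le (1+2x)\left[F(1-x^3)+\frac{2(R(a,b)-\log 27)}{B(a,b)}\right].$$ (4) For $(a,b)\in D_6$ and each $x\in(0,1)$, $$0\le (1+2x)F(1-x^3)-3F\left(\left(\tfrac{1-x}{1+2x}\right)^3\right)\le \frac{2(1+2x)(\log 27-R(a,b))}{B(a,b)}.$$ -/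

import Mathlib

noncomputable section

namespace CubicTransformation

/-- The zero-balanced Gaussian hypergeometric function `F(a,b;a+b;x)` of a real variable: the sum
of the series `∑ (a,n)(b,n)/(a+b,n) * x^n/n!`. -/
def F (a b x : ℝ) : ℝ := ordinaryHypergeometric a b (a + b) x

/-- The classical beta function `B(a,b) = Γ(a)Γ(b)/Γ(a+b)` at real arguments. -/
def B (a b : ℝ) : ℝ := ProbabilityTheory.beta a b

/-- The digamma function `Ψ = Γ'/Γ` on the real line. -/
def Psi (z : ℝ) : ℝ := logDeriv Real.Gamma z

/-- The Ramanujan constant function `R(a,b) = -Ψ(a) - Ψ(b) - 2γ`. -/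
def R (a b : ℝ) : ℝ := -Psi a - Psi b - 2 * Real.eulerMascheroniConstant

/-- The parameter region `D₁`. -/
def D1 : Set (ℝ × ℝ) :=
  {p | 0 < p.1 ∧ 0 < p.2 ∧ p.1 * p.2 ≤ 2 / 9 ∧ p.1 * p.2 - 2 / 9 * (p.1 + p.2) ≤ 0}

/-- The parameter region `D₃`. -/
def D3 : Set (ℝ × ℝ) :=
  {p | 0 < p.1 ∧ 0 < p.2 ∧ 2 / 9 ≤ p.1 * p.2 ∧ 0 ≤ p.1 * p.2 - 2 / 9 * (p.1 + p.2)}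

/-- The parameter region `D₅`. -/
def D5 : Set (ℝ × ℝ) :=
  {p | 0 < p.1 ∧ 0 < p.2 ∧ p.1 + p.2 ≤ 1 ∧ p.1 * p.2 - 2 / 9 * (p.1 + p.2) ≤ 0}

/-- The parameter region `D₆`. -/
def D6 : Set (ℝ × ℝ) :=
  {p | 0 < p.1 ∧ 0 < p.2 ∧ 1 ≤ p.1 + p.2 ∧ 0 ≤ p.1 * p.2 - 2 / 9 * (p.1 + p.2)}

end CubicTransformation

end

open Filter Topology

/-! For `(a, b) = (1/3, 2/3)` all the bounds are equalities: writing `F₀`, `B₀` for this case, `y =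
((1-x)/(1+2x))^3` and `z = 1-x^3`, Ramanujan's cubic transformation says `3 F₀(y) = (1+2x) F₀(z)`.
It holds because both sides solve one self-adjoint second-order equation, and their Wronskian
vanishes at the singular point `x = 1`, where they agree.

General parameters are compared with this case through the coefficients of `B F`, which are
asymptotic to `1/n`. On `D1` the quotient of the coefficients of `B F` by those of `B₀ F₀` decreases
to its limit `1`; on `D3` the inverse quotient does. On `D1` this gives `F/F₀` decreasing, `F ≤ F₀`
and `B F ≥ B₀ F₀`. Since `y ≤ z`, these yield both bounds on the quotient.

For the additive bounds, `B F - B₀ F₀` has nonnegative coefficients on `D5 ⊆ D1`, so it increases on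
`[0,1)` and is at most the sum of its coefficients. That sum is `R(a,b) - R(1/3,2/3) = R(a,b) - log
27`, by the asymptotics `log N - Ψ(a) - Ψ(b) - γ` of the partial sums. The regions `D3` and `D6`
follow with the two series exchanged. -/

namespace CubicTransformation

/-! ### Normalised coefficients and their asymptotics -/

/-- The coefficients of `B(a,b) F(a,b;a+b;x)`. -/
noncomputable def betaCoeff (a b : ℝ) (n : ℕ) : ℝ :=
  Real.Gamma (a + n) * Real.Gamma (b + n) / (Real.Gamma (a + b + n) * n.factorial)

lemma betaCoeff_comm (a b : ℝ) (n : ℕ) : betaCoeff a b n = betaCoeff b a n := by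
  simp only [betaCoeff, add_comm a b, mul_comm (Real.Gamma (a + n))]

lemma betaCoeff_zero (a b : ℝ) : betaCoeff a b 0 = B a b := by
  simp [betaCoeff, B, ProbabilityTheory.beta]

lemma B_pos {a b : ℝ} (ha : 0 < a) (hb : 0 < b) : 0 < B a b :=
  ProbabilityTheory.beta_pos ha hb

lemma betaCoeff_pos {a b : ℝ} (ha : 0 < a) (hb : 0 < b) (n : ℕ) : 0 < betaCoeff a b n := by
  have h1 : 0 < Real.Gamma (a + n) := Real.Gamma_pos_of_pos (by positivity)
  have h2 : 0 < Real.Gamma (b + n) := Real.Gamma_pos_of_pos (by positivity)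
  have h3 : 0 < Real.Gamma (a + b + n) := Real.Gamma_pos_of_pos (by positivity)
  unfold betaCoeff
  positivity

lemma betaCoeff_succ {a b : ℝ} (ha : 0 < a) (hb : 0 < b) (n : ℕ) :
    betaCoeff a b (n + 1) * ((a + b + n) * (n + 1)) = betaCoeff a b n * ((a + n) * (b + n)) := by
  have h3 : 0 < Real.Gamma (a + b + n) := Real.Gamma_pos_of_pos (by positivity)
  have e : ∀ c : ℝ, 0 < c → Real.Gamma (c + ((n + 1 : ℕ) : ℝ)) = (c + n) * Real.Gamma (c + n) := by
    intro c hc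
    rw [← Real.Gamma_add_one (by positivity)]
    push_cast
    ring_nf
  have h4 : 0 < a + b + n := by positivity
  unfold betaCoeff
  rw [e a ha, e b hb, e (a + b) (by positivity), Nat.factorial_succ]
  push_cast
  field_simp

lemma Gamma_add_nat_mul_GammaSeq {a : ℝ} (ha : 0 < a) (n : ℕ) :
    Real.Gamma (a + (n + 1 : ℕ)) * Real.GammaSeq a n =
      (n : ℝ) ^ a * n.factorial * Real.Gamma a := by
  have h : ∀ m : ℕ, Real.Gamma (a + m) = (∏ j ∈ Finset.range m, (a + j)) * Real.Gamma a := by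
    intro m
    induction m with
    | zero => simp
    | succ m ih =>
      rw [Finset.prod_range_succ, mul_right_comm, ← ih, mul_comm,
        ← Real.Gamma_add_one (by positivity)]
      push_cast
      ring_nf
  have hp : (∏ j ∈ Finset.range (n + 1), (a + j)) ≠ 0 :=
    (Finset.prod_pos fun j _ => by positivity).ne'
  rw [h, Real.GammaSeq]
  field_simp

/-- Euler's limit formula gives `Γ(c+n+1) ~ n^c n!`; the powers of `n` cancel because the series is
zero-balanced. -/
lemma tendsto_nat_mul_betaCoeff {a b : ℝ} (ha : 0 < a) (hb : 0 < b) :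
    Tendsto (fun n : ℕ => n * betaCoeff a b n) atTop (𝓝 1) := by
  rw [← tendsto_add_atTop_iff_nat 1]
  have hs : 0 < a + b := by positivity
  have t : ∀ c : ℝ, 0 < c → Tendsto (fun n => Real.Gamma c / Real.GammaSeq c n) atTop (𝓝 1) := by
    intro c hc
    have := (tendsto_const_nhds (x := Real.Gamma c)).div (Real.GammaSeq_tendsto_Gamma c)
      (Real.Gamma_pos_of_pos hc).ne'
    rwa [div_self (Real.Gamma_pos_of_pos hc).ne'] at this
  have T := ((t a ha).mul (t b hb)).div (t _ hs) one_ne_zero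
  rw [mul_one, div_one] at T
  refine T.congr' ?_
  filter_upwards [eventually_gt_atTop 0] with n hn
  have hn' : (0 : ℝ) < n := by exact_mod_cast hn
  have sp : ∀ c : ℝ, 0 < c → 0 < Real.GammaSeq c n := by
    intro c hc
    have : 0 < ∏ j ∈ Finset.range (n + 1), (c + j) := Finset.prod_pos fun j _ => by positivity
    unfold Real.GammaSeq
    positivity
  have e : ∀ c : ℝ, 0 < c → Real.Gamma c / Real.GammaSeq c n =
      Real.Gamma (c + (n + 1 : ℕ)) / ((n : ℝ) ^ c * n.factorial) := by
    intro c hc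
    have := sp c hc
    have h2 : 0 < (n : ℝ) ^ c := by positivity
    rw [div_eq_div_iff (by positivity) (by positivity), Gamma_add_nat_mul_GammaSeq hc n]
    ring
  have h3 : 0 < Real.Gamma (a + b + (n + 1 : ℕ)) := Real.Gamma_pos_of_pos (by positivity)
  have h4 : 0 < (n : ℝ) ^ a := by positivity
  have h5 : 0 < (n : ℝ) ^ b := by positivity
  simp only [Pi.div_apply]
  rw [e a ha, e b hb, e _ hs, betaCoeff, Nat.factorial_succ, Real.rpow_add hn']
  field_simp
  push_cast
  ring

lemma exists_betaCoeff_le {a b : ℝ} (ha : 0 < a) (hb : 0 < b) :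
    ∃ C, ∀ n, |betaCoeff a b n| ≤ C := by
  obtain ⟨M, hM⟩ := (tendsto_nat_mul_betaCoeff ha hb).bddAbove_range
  refine ⟨max M (betaCoeff a b 0), fun n => ?_⟩
  rw [abs_of_pos (betaCoeff_pos ha hb n)]
  rcases Nat.eq_zero_or_pos n with rfl | hn
  · exact le_max_right _ _
  · have h1 : (1 : ℝ) ≤ n := by exact_mod_cast hn
    refine le_max_of_le_left (le_trans ?_ (hM ⟨n, rfl⟩))
    exact le_mul_of_one_le_left (betaCoeff_pos ha hb n).le h1

/-! ### Power series with bounded coefficients, and the series of `B F` -/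

lemma summable_mul_pow_of_bounded {c : ℕ → ℝ} {C x : ℝ} (hc : ∀ n, |c n| ≤ C) (hx : |x| < 1) :
    Summable fun n => c n * x ^ n := by
  refine Summable.of_norm_bounded ((summable_geometric_of_lt_one (abs_nonneg x) hx).mul_left C) ?_
  intro n
  rw [Real.norm_eq_abs, abs_mul, abs_pow]
  gcongr
  exact hc n

lemma hasDerivAt_tsum_mul_pow {c : ℕ → ℝ} {C x : ℝ} (hc : ∀ n, |c n| ≤ C) (hx : |x| < 1) :
    HasDerivAt (fun t => ∑' n, c n * t ^ n) (∑' n : ℕ, c n * (n * x ^ (n - 1))) x := by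
  obtain ⟨r, hxr, hr⟩ := exists_between hx
  have hr0 : 0 < r := (abs_nonneg x).trans_lt hxr
  have hsum : Summable fun n : ℕ => C * (n * r ^ (n - 1)) := by
    refine Summable.mul_left C ?_
    rw [← summable_nat_add_iff 1]
    have h1 := summable_pow_mul_geometric_of_norm_lt_one 1
      (by rwa [Real.norm_of_nonneg hr0.le] : ‖r‖ < 1)
    have h2 := summable_geometric_of_lt_one hr0.le hr
    refine (h1.add h2).congr fun n => ?_
    simp
    ring
  refine hasDerivAt_tsum_of_isPreconnected (t := Set.Ioo (-r) r) (y₀ := 0) hsum isOpen_Ioo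
    isPreconnected_Ioo (fun n y _ => (hasDerivAt_pow n y).const_mul (c n)) ?_ ?_ ?_ ?_
  · intro n y hy
    have hy' : |y| ≤ r := (abs_lt.2 hy).le
    rw [Real.norm_eq_abs, abs_mul, abs_mul, abs_pow, Nat.abs_cast]
    gcongr
    · exact (abs_nonneg _).trans (hc n)
    · exact hc n
  · exact ⟨by linarith, hr0⟩
  · exact summable_mul_pow_of_bounded hc (by simp)
  · exact abs_lt.1 hxr

lemma betaCoeff_eq {a b : ℝ} (ha : 0 < a) (hb : 0 < b) (n : ℕ) :
    betaCoeff a b n = B a b * ((n.factorial⁻¹ : ℝ) * (ascPochhammer ℝ n).eval a *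
      (ascPochhammer ℝ n).eval b * ((ascPochhammer ℝ n).eval (a + b))⁻¹) := by
  induction n with
  | zero => simp [betaCoeff_zero]
  | succ n ih =>
    have h1 := betaCoeff_succ ha hb n
    have h2 : 0 < (a + b + n) * ((n : ℝ) + 1) := by positivity
    rw [← eq_div_iff h2.ne'] at h1
    have h3 : 0 < (ascPochhammer ℝ n).eval (a + b) := ascPochhammer_pos n _ (by positivity)
    rw [h1, ih, ascPochhammer_succ_eval, ascPochhammer_succ_eval, ascPochhammer_succ_eval,
      Nat.factorial_succ]
    push_cast
    field_simp

lemma B_mul_F_eq_tsum {a b : ℝ} (ha : 0 < a) (hb : 0 < b) (x : ℝ) :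
    B a b * F a b x = ∑' n, betaCoeff a b n * x ^ n := by
  rw [F, ordinaryHypergeometric_eq_tsum, ← tsum_mul_left]
  refine tsum_congr fun n => ?_
  rw [betaCoeff_eq ha hb, smul_eq_mul]
  ring

lemma hasSum_betaCoeff {a b x : ℝ} (ha : 0 < a) (hb : 0 < b) (hx : |x| < 1) :
    HasSum (fun n => betaCoeff a b n * x ^ n) (B a b * F a b x) := by
  obtain ⟨C, hC⟩ := exists_betaCoeff_le ha hb
  rw [B_mul_F_eq_tsum ha hb]
  exact (summable_mul_pow_of_bounded hC hx).hasSum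

lemma F_pos {a b x : ℝ} (ha : 0 < a) (hb : 0 < b) (h0 : 0 ≤ x) (h1 : x < 1) : 0 < F a b x := by
  have h := hasSum_betaCoeff ha hb (abs_lt.2 ⟨by linarith, h1⟩)
  have := le_hasSum h 0 fun n _ => mul_nonneg (betaCoeff_pos ha hb n).le (pow_nonneg h0 n)
  rw [betaCoeff_zero, pow_zero] at this
  exact lt_of_lt_of_le one_pos (le_of_mul_le_mul_left this (B_pos ha hb))

/-! ### The digamma function and the partial sums of the coefficients -/

lemma hasDerivAt_log_Gamma {x : ℝ} (hx : 0 < x) :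
    HasDerivAt (fun y => Real.log (Real.Gamma y)) (Psi x) x := by
  have hd : DifferentiableAt ℝ Real.Gamma x :=
    Real.differentiableAt_Gamma fun m => by
      have : (0 : ℝ) ≤ m := m.cast_nonneg
      linarith
  exact hd.hasDerivAt.log (Real.Gamma_pos_of_pos hx).ne'

lemma Psi_add_one {x : ℝ} (hx : 0 < x) : Psi (x + 1) = Psi x + 1 / x := by
  have h1 := (hasDerivAt_log_Gamma (by linarith : 0 < x + 1)).comp_add_const x 1
  have h2 := (hasDerivAt_log_Gamma hx).add (Real.hasDerivAt_log hx.ne')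
  rw [one_div]
  refine (h1.congr_of_eventuallyEq ?_).unique h2
  filter_upwards [lt_mem_nhds hx] with y hy
  rw [Real.Gamma_add_one hy.ne', Real.log_mul hy.ne' (Real.Gamma_pos_of_pos hy).ne', add_comm]
  rfl

lemma monotoneOn_Psi : MonotoneOn Psi (Set.Ioi 0) := by
  have h := Real.convexOn_log_Gamma.monotoneOn_deriv
    fun x hx => (hasDerivAt_log_Gamma hx).differentiableAt
  exact h.congr fun x hx => (hasDerivAt_log_Gamma hx).deriv

lemma Psi_one : Psi 1 = -Real.eulerMascheroniConstant := by
  simp [Psi, logDeriv, Real.hasDerivAt_Gamma_one.deriv]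

/-- The points `x + b` and `y` are complementary convex combinations of `x` and `y + b`, so
log-convexity of `Γ` applies twice. -/
lemma log_Gamma_add_le {x y b : ℝ} (hx : 0 < x) (hxy : x ≤ y) (hb : 0 < b) :
    Real.log (Real.Gamma (x + b)) + Real.log (Real.Gamma y) ≤
      Real.log (Real.Gamma x) + Real.log (Real.Gamma (y + b)) := by
  have hD : 0 < y - x + b := by linarith
  have hl : 0 ≤ b / (y - x + b) := by positivity
  have hl' : 0 ≤ (y - x) / (y - x + b) := div_nonneg (by linarith) hD.le
  have hs : (y - x) / (y - x + b) + b / (y - x + b) = 1 := by field_simp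
  have hX : x ∈ Set.Ioi (0 : ℝ) := hx
  have hY : y + b ∈ Set.Ioi (0 : ℝ) := by
    simp only [Set.mem_Ioi]
    linarith
  have h1 := Real.convexOn_log_Gamma.2 hX hY hl' hl hs
  have h2 := Real.convexOn_log_Gamma.2 hX hY hl hl' (by rw [add_comm, hs])
  have e1 : (y - x) / (y - x + b) * x + b / (y - x + b) * (y + b) = x + b := by
    field_simp
    ring
  have e2 : b / (y - x + b) * x + (y - x) / (y - x + b) * (y + b) = y := by
    field_simp
    ring
  simp only [smul_eq_mul, Function.comp_apply, e1, e2] at h1 h2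
  refine (add_le_add h1 h2).trans_eq ?_
  linear_combination
    (Real.log (Real.Gamma x) + Real.log (Real.Gamma (y + b))) * hs

lemma betaCoeff_anti {x y b : ℝ} (hx : 0 < x) (hxy : x ≤ y) (hb : 0 < b) (n : ℕ) :
    betaCoeff y b n ≤ betaCoeff x b n := by
  have hy : 0 < y := hx.trans_le hxy
  have g1 : 0 < Real.Gamma (x + n) := Real.Gamma_pos_of_pos (by positivity)
  have g2 : 0 < Real.Gamma (y + n) := Real.Gamma_pos_of_pos (by positivity)
  have g3 : 0 < Real.Gamma (x + b + n) := Real.Gamma_pos_of_pos (by positivity)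
  have g4 : 0 < Real.Gamma (y + b + n) := Real.Gamma_pos_of_pos (by positivity)
  have g5 : 0 < Real.Gamma (b + n) := Real.Gamma_pos_of_pos (by positivity)
  have h := log_Gamma_add_le (by positivity : 0 < x + n) (by gcongr : x + n ≤ y + n) hb
  rw [add_right_comm x, add_right_comm y, ← Real.log_mul g3.ne' g2.ne',
    ← Real.log_mul g1.ne' g4.ne', Real.log_le_log_iff (by positivity) (by positivity)] at h
  unfold betaCoeff
  rw [div_le_div_iff₀ (by positivity) (by positivity)]
  have := mul_le_mul_of_nonneg_left h (by positivity : 0 ≤ Real.Gamma (b + n) * n.factorial)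
  linarith

lemma betaCoeff_add_one_left {a b : ℝ} (ha : 0 < a) (hb : 0 < b) (n : ℕ) :
    betaCoeff (a + 1) b n = betaCoeff a b n * ((a + n) / (a + b + n)) := by
  have h1 : 0 < a + n := by positivity
  have h2 : 0 < a + b + n := by positivity
  have g1 : 0 < Real.Gamma (a + b + n) := Real.Gamma_pos_of_pos h2
  unfold betaCoeff
  rw [show a + 1 + n = a + n + 1 by ring, show a + 1 + b + n = a + b + n + 1 by ring,
    Real.Gamma_add_one h1.ne', Real.Gamma_add_one h2.ne']
  field_simp

/-- Telescoping: with `c n = betaCoeff a b n`, the recurrence gives `b * c n / (a+b+n) = ((n+1) * c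
(n+1) - n * c n) / a`, and the left side is the drop in the `n`-th coefficient. -/
lemma sum_betaCoeff_add_one_left {a b : ℝ} (ha : 0 < a) (hb : 0 < b) (N : ℕ) :
    ∑ n ∈ Finset.range N, betaCoeff (a + 1) b n =
      ∑ n ∈ Finset.range N, betaCoeff a b n - N * betaCoeff a b N / a := by
  induction N with
  | zero => simp
  | succ N ih =>
    have h := betaCoeff_succ ha hb N
    have h2 : 0 < a + b + N := by positivity
    have e : ((N + 1 : ℕ) : ℝ) * betaCoeff a b (N + 1) =
        betaCoeff a b N * ((a + N) * (b + N)) / (a + b + N) := by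
      rw [eq_div_iff h2.ne', ← h]
      push_cast
      ring
    rw [Finset.sum_range_succ, Finset.sum_range_succ, ih, e, betaCoeff_add_one_left ha hb]
    field_simp
    ring

/-- The defect in the asymptotic formula `∑_{n<N} betaCoeff a b n ≈ log N - Ψ(a) - Ψ(b) - γ`. -/
noncomputable def sumDefect (a b : ℝ) (N : ℕ) : ℝ :=
  ∑ n ∈ Finset.range N, betaCoeff a b n - Real.log N -
    (-Psi a - Psi b - Real.eulerMascheroniConstant)

lemma sumDefect_comm (a b : ℝ) : sumDefect a b = sumDefect b a := by
  funext N
  simp only [sumDefect, betaCoeff_comm a b]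
  ring

/-- The boundary term tends to `-1/a`, which cancels the jump of `Ψ` from `a` to `a + 1`. -/
lemma tendsto_sumDefect_add_one_sub {a b : ℝ} (ha : 0 < a) (hb : 0 < b) :
    Tendsto (fun N => sumDefect (a + 1) b N - sumDefect a b N) atTop (𝓝 0) := by
  have h := ((tendsto_nat_mul_betaCoeff ha hb).const_mul (-(1 / a))).add_const (1 / a)
  rw [mul_one, neg_add_cancel] at h
  refine h.congr fun N => ?_
  rw [sumDefect, sumDefect, sum_betaCoeff_add_one_left ha hb, Psi_add_one ha]
  ring

lemma tendsto_sumDefect_add_nat_sub {a b : ℝ} (ha : 0 < a) (hb : 0 < b) (m : ℕ) :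
    Tendsto (fun N => sumDefect (a + m) b N - sumDefect a b N) atTop (𝓝 0) := by
  induction m with
  | zero => simp
  | succ m ih =>
    have h := (tendsto_sumDefect_add_one_sub (by positivity : 0 < a + m) hb).add ih
    rw [add_zero] at h
    refine h.congr fun N => ?_
    push_cast
    rw [← add_assoc]
    ring

/-- The partial sums decrease in the first parameter, while `Ψ` grows by at most `1/x` on `[x,
x+1]`. -/
lemma sumDefect_le {x y b : ℝ} (hx : 0 < x) (hxy : x ≤ y) (hyx : y ≤ x + 1) (hb : 0 < b) (N : ℕ) :
    sumDefect y b N ≤ sumDefect x b N + 1 / x := by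
  have h1 : ∑ n ∈ Finset.range N, betaCoeff y b n ≤ ∑ n ∈ Finset.range N, betaCoeff x b n :=
    Finset.sum_le_sum fun n _ => betaCoeff_anti hx hxy hb n
  have h2 : Psi y ≤ Psi (x + 1) :=
    monotoneOn_Psi (hx.trans_le hxy) (by simp only [Set.mem_Ioi]; linarith) hyx
  rw [Psi_add_one hx] at h2
  unfold sumDefect
  linarith

/-- A Bohr–Mollerup type squeeze: integer shifts do not affect the limit, so `a` may be moved far to
the right, where it lies between consecutive integers and the error `1/x` of `sumDefect_le` is
small. -/
lemma tendsto_sumDefect_of_one {a b : ℝ} (ha : 0 < a) (hb : 0 < b)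
    (h : Tendsto (sumDefect 1 b) atTop (𝓝 0)) : Tendsto (sumDefect a b) atTop (𝓝 0) := by
  have hnat : ∀ k : ℕ, Tendsto (sumDefect (1 + k) b) atTop (𝓝 0) := by
    intro k
    have := (tendsto_sumDefect_add_nat_sub one_pos hb k).add h
    simpa using this
  rw [Metric.tendsto_atTop']
  intro ε hε
  obtain ⟨m, hm⟩ := exists_nat_one_div_lt (half_pos hε)
  -- Chosen so that `1 + k ≤ a + (m + 1) ≤ 1 + k + 1`; both squeeze errors are then at most `1/(m+1)
  -- < ε/2`.
  set k := ⌊a⌋₊ + m with hk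
  have hka : (1 + k : ℝ) ≤ a + (m + 1 : ℕ) := by
    have := Nat.floor_le ha.le
    push_cast [hk]
    linarith
  have hak : a + (m + 1 : ℕ) ≤ 1 + k + 1 := by
    have := (Nat.lt_floor_add_one a).le
    push_cast [hk]
    linarith
  have hk1 : 1 / (1 + k : ℝ) ≤ 1 / ((m : ℝ) + 1) := by
    have : (0 : ℝ) ≤ ⌊a⌋₊ := Nat.cast_nonneg _
    apply one_div_le_one_div_of_le (by positivity)
    push_cast [hk]
    linarith
  have hk2 : 1 / (a + (m + 1 : ℕ)) ≤ 1 / ((m : ℝ) + 1) := by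
    apply one_div_le_one_div_of_le (by positivity)
    push_cast
    linarith
  have T := ((tendsto_sumDefect_add_nat_sub ha hb (m + 1)).abs.add (hnat k).abs).add
    (hnat (k + 1)).abs
  simp only [abs_zero, add_zero] at T
  obtain ⟨N₀, hN₀⟩ := eventually_atTop.1 (T.eventually_lt_const (half_pos hε))
  refine ⟨N₀, fun N hN => ?_⟩
  have hT := hN₀ N hN.le
  have u1 := sumDefect_le (by positivity : (0 : ℝ) < 1 + k) hka hak hb N
  have u2 := sumDefect_le (by positivity : (0 : ℝ) < a + (m + 1 : ℕ)) hak (by linarith) hb N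
  rw [show (1 : ℝ) + k + 1 = 1 + (k + 1 : ℕ) by push_cast; ring] at u2
  rw [Real.dist_eq, sub_zero, abs_lt]
  have a1 := le_abs_self (sumDefect (a + (m + 1 : ℕ)) b N - sumDefect a b N)
  have a2 := neg_abs_le (sumDefect (a + (m + 1 : ℕ)) b N - sumDefect a b N)
  have a3 := le_abs_self (sumDefect (1 + k) b N)
  have a4 := neg_abs_le (sumDefect (1 + (k + 1 : ℕ)) b N)
  have a5 := abs_nonneg (sumDefect (1 + k) b N)
  have a6 := abs_nonneg (sumDefect (1 + (k + 1 : ℕ)) b N)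
  constructor <;> linarith

lemma betaCoeff_one_right {b : ℝ} (hb : 0 < b) (n : ℕ) : betaCoeff b 1 n = 1 / (b + n) := by
  have h1 : 0 < b + n := by positivity
  have g := Real.Gamma_pos_of_pos h1
  have hf : (n.factorial : ℝ) ≠ 0 := by positivity
  rw [betaCoeff, add_right_comm, Real.Gamma_add_one h1.ne', add_comm 1 (n : ℝ),
    Real.Gamma_nat_eq_factorial]
  field_simp

lemma tendsto_sumDefect_one_one : Tendsto (sumDefect 1 1) atTop (𝓝 0) := by
  have h := Real.tendsto_harmonic_sub_log.sub_const Real.eulerMascheroniConstant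
  rw [sub_self] at h
  refine h.congr fun N => ?_
  rw [sumDefect, Psi_one, harmonic]
  push_cast
  simp only [betaCoeff_one_right one_pos, one_div, add_comm (1 : ℝ)]
  ring

/-- By symmetry both parameters reduce to `1`, where the partial sums are harmonic numbers. -/
lemma tendsto_sumDefect {a b : ℝ} (ha : 0 < a) (hb : 0 < b) :
    Tendsto (sumDefect a b) atTop (𝓝 0) := by
  refine tendsto_sumDefect_of_one ha hb ?_
  rw [sumDefect_comm]
  exact tendsto_sumDefect_of_one hb one_pos tendsto_sumDefect_one_one

lemma tendsto_sum_betaCoeff_sub {a b c d : ℝ} (ha : 0 < a) (hb : 0 < b) (hc : 0 < c)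
    (hd : 0 < d) :
    Tendsto (fun N => ∑ n ∈ Finset.range N, (betaCoeff a b n - betaCoeff c d n)) atTop
      (𝓝 (R a b - R c d)) := by
  have h := ((tendsto_sumDefect ha hb).sub (tendsto_sumDefect hc hd)).add_const (R a b - R c d)
  rw [sub_zero, zero_add] at h
  refine h.congr fun N => ?_
  rw [Finset.sum_sub_distrib, sumDefect, sumDefect, R, R]
  ring

lemma tendsto_sum_inv_add_sub_log {b : ℝ} (hb : 0 < b) :
    Tendsto (fun N : ℕ => ∑ n ∈ Finset.range N, 1 / (b + n) - Real.log N) atTop (𝓝 (-Psi b)) := by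
  have h := (tendsto_sumDefect hb one_pos).add_const (-Psi b)
  rw [zero_add] at h
  refine h.congr fun N => ?_
  simp only [sumDefect, betaCoeff_one_right hb, Psi_one]
  ring

lemma sum_range_three_mul (N : ℕ) :
    3 * ((harmonic (3 * N) : ℚ) : ℝ) = ∑ n ∈ Finset.range N, 1 / ((1 / 3 : ℝ) + n) +
      ∑ n ∈ Finset.range N, 1 / ((2 / 3 : ℝ) + n) + ∑ n ∈ Finset.range N, 1 / ((1 : ℝ) + n) := by
  induction N with
  | zero => simp
  | succ N ih =>
    rw [Finset.sum_range_succ, Finset.sum_range_succ, Finset.sum_range_succ,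
      show 3 * (N + 1) = 3 * N + 1 + 1 + 1 by ring, harmonic_succ, harmonic_succ, harmonic_succ]
    push_cast
    rw [mul_add, mul_add, mul_add, ih]
    field_simp
    ring

/-- Splitting `3 H_{3N}` by residues mod `3` and comparing with `log (3N)` gives `-Ψ(1/3) - Ψ(2/3) +
γ = 3γ + 3 log 3`. -/
lemma R_one_third_two_thirds : R (1 / 3) (2 / 3) = Real.log 27 := by
  have h1 := ((tendsto_sum_inv_add_sub_log (by norm_num : (0 : ℝ) < 1 / 3)).add
    (tendsto_sum_inv_add_sub_log (by norm_num : (0 : ℝ) < 2 / 3))).add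
    (tendsto_sum_inv_add_sub_log (one_pos))
  have h2 := ((Real.tendsto_harmonic_sub_log.comp
    (tendsto_id.const_mul_atTop' (by norm_num : 0 < 3))).const_mul 3).add_const (3 * Real.log 3)
  have h3 := tendsto_nhds_unique (h1.congr' ?_) h2
  · rw [Psi_one] at h3
    rw [R, show (27 : ℝ) = 3 ^ 3 by norm_num, Real.log_pow]
    push_cast
    linarith
  · filter_upwards [eventually_gt_atTop 0] with N hN
    have hN' : (N : ℝ) ≠ 0 := by exact_mod_cast hN.ne'
    simp only [Function.comp_apply, id_eq, mul_sub, sum_range_three_mul]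
    push_cast
    rw [Real.log_mul (by norm_num) hN']
    ring

/-! ### The hypergeometric equation and the cubic transformation -/

/-- The hypergeometric differential equation in self-adjoint form, for parameters with
`a + b = 1`. -/
lemma exists_deriv_hypergeometric {a b : ℝ} (ha : 0 < a) (hb : 0 < b) (hab : a + b = 1) :
    ∃ V : ℝ → ℝ, ∀ t, |t| < 1 → HasDerivAt (fun t => B a b * F a b t) (V t) t ∧
      HasDerivAt (fun t => t * (1 - t) * V t) (a * b * (B a b * F a b t)) t := by
  set c := betaCoeff a b with hc
  obtain ⟨C, hC⟩ := exists_betaCoeff_le ha hb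
  obtain ⟨M, hM⟩ := (tendsto_nat_mul_betaCoeff ha hb).bddAbove_range
  have hM' : ∀ n : ℕ, |n * c n| ≤ M := fun n => by
    rw [abs_of_nonneg (mul_nonneg n.cast_nonneg (betaCoeff_pos ha hb n).le)]
    exact hM ⟨n, rfl⟩
  have hU : (fun t => B a b * F a b t) = fun t => ∑' n, c n * t ^ n :=
    funext fun t => B_mul_F_eq_tsum ha hb t
  have hCnn : 0 ≤ C := (abs_nonneg _).trans (hC 0)
  have hrec : ∀ n : ℕ, ((n + 1 : ℕ) : ℝ) * c (n + 1) - n * c n = a * b * c n / (n + 1 : ℕ) := by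
    intro n
    have h := betaCoeff_succ ha hb n
    have e : a + b + n = n + 1 := by rw [hab, add_comm]
    rw [e] at h
    have hn : (0 : ℝ) < n + 1 := by positivity
    push_cast
    rw [eq_div_iff hn.ne', hc]
    linear_combination h + betaCoeff a b n * n * hab
  -- The coefficients of `t (1-t) U'`, as `hrec` shows; division by zero makes `d 0 = 0`, the
  -- correct constant term.
  set d : ℕ → ℝ := fun m => a * b * c (m - 1) / m with hd
  have hdb : ∀ m, |d m| ≤ a * b * C := by
    intro m
    rcases Nat.eq_zero_or_pos m with rfl | hm
    · simp only [hd, Nat.cast_zero, div_zero, abs_zero]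
      positivity
    · have h1 : (1 : ℝ) ≤ m := by exact_mod_cast hm
      simp only [hd]
      rw [abs_div, abs_mul, abs_of_pos (mul_pos ha hb), Nat.abs_cast]
      refine (div_le_self (by positivity) h1).trans ?_
      gcongr
      exact hC _
  have key : ∀ t : ℝ, |t| < 1 →
      t * (1 - t) * (∑' n : ℕ, c n * (n * t ^ (n - 1))) = ∑' m, d m * t ^ m := by
    intro t ht
    have s1 : Summable fun n : ℕ => (n * c n) * t ^ n := summable_mul_pow_of_bounded hM' ht
    have s2 : Summable fun n : ℕ => ((n + 1 : ℕ) * c (n + 1)) * t ^ (n + 1) :=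
      (summable_nat_add_iff 1).2 s1
    have s3 : Summable fun m => d m * t ^ m := summable_mul_pow_of_bounded hdb ht
    have e1 : t * (∑' n : ℕ, c n * (n * t ^ (n - 1))) = ∑' n : ℕ, (n * c n) * t ^ n := by
      rw [← tsum_mul_left]
      refine tsum_congr fun n => ?_
      rcases n with _ | n
      · simp
      · rw [Nat.add_sub_cancel, pow_succ]
        ring
    have e2 : ∑' n : ℕ, (n * c n) * t ^ n = ∑' n : ℕ, ((n + 1 : ℕ) * c (n + 1)) * t ^ (n + 1) := by
      rw [s1.tsum_eq_zero_add]
      simp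
    rw [mul_right_comm, e1, mul_sub, mul_one]
    nth_rewrite 1 [e2]
    rw [← tsum_mul_right, ← s2.tsum_sub (s1.mul_right t), s3.tsum_eq_zero_add]
    have e0 : d 0 * t ^ 0 = 0 := by simp [hd]
    rw [e0, zero_add]
    refine tsum_congr fun n => ?_
    simp only [hd, Nat.add_sub_cancel]
    rw [← hrec n]
    ring
  refine ⟨fun t => ∑' n : ℕ, c n * (n * t ^ (n - 1)), fun t ht => ⟨?_, ?_⟩⟩
  · rw [hU]
    exact hasDerivAt_tsum_mul_pow hC ht
  · have h := hasDerivAt_tsum_mul_pow hdb ht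
    have s : Summable fun m : ℕ => d m * (m * t ^ (m - 1)) := by
      rw [← summable_nat_add_iff 1]
      refine ((summable_mul_pow_of_bounded hC ht).mul_left (a * b)).congr fun n => ?_
      simp only [hd, Nat.add_sub_cancel]
      have hn : ((n + 1 : ℕ) : ℝ) ≠ 0 := by positivity
      field_simp
      exact mul_comm _ _
    have e : ∑' m : ℕ, d m * (m * t ^ (m - 1)) = a * b * (B a b * F a b t) := by
      rw [s.tsum_eq_zero_add, B_mul_F_eq_tsum ha hb, ← tsum_mul_left]
      simp only [Nat.cast_zero, zero_mul, mul_zero, zero_add, hd, Nat.add_sub_cancel]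
      refine tsum_congr fun n => ?_
      have hn : ((n + 1 : ℕ) : ℝ) ≠ 0 := by positivity
      field_simp
      exact mul_comm _ _
    rw [e] at h
    refine h.congr_of_eventuallyEq ?_
    filter_upwards [(isOpen_lt continuous_abs continuous_const).mem_nhds ht] with u hu
    exact key u hu

lemma hasDerivAt_cubicArg {x : ℝ} (hx : 0 < 1 + 2 * x) :
    HasDerivAt (fun x : ℝ => ((1 - x) / (1 + 2 * x)) ^ 3)
      (-9 * (1 - x) ^ 2 / (1 + 2 * x) ^ 4) x := by
  have h1 : HasDerivAt (fun x : ℝ => 1 - x) (-1) x := (hasDerivAt_id x).const_sub 1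
  have h2 : HasDerivAt (fun x : ℝ => 1 + 2 * x) (2 * 1) x :=
    ((hasDerivAt_id x).const_mul 2).const_add 1
  have hne := hx.ne'
  refine ((h1.div h2 hne).pow 3).congr_deriv ?_
  simp only [Pi.div_apply, Nat.add_one_sub_one]
  field_simp
  push_cast
  ring

lemma cubicArg_nonneg {x : ℝ} (h0 : 0 < x) (h1 : x ≤ 1) : 0 ≤ ((1 - x) / (1 + 2 * x)) ^ 3 :=
  pow_nonneg (div_nonneg (by linarith) (by linarith)) 3

lemma cubicArg_lt_one {x : ℝ} (h0 : 0 < x) (h1 : x ≤ 1) : ((1 - x) / (1 + 2 * x)) ^ 3 < 1 := by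
  refine pow_lt_one₀ (div_nonneg (by linarith) (by linarith)) ?_ (by norm_num)
  rw [div_lt_one (by linarith)]
  linarith

lemma one_sub_cube_nonneg {x : ℝ} (h0 : 0 < x) (h1 : x ≤ 1) : 0 ≤ 1 - x ^ 3 := by
  linarith [pow_le_one₀ (n := 3) h0.le h1]

lemma one_sub_cube_lt_one {x : ℝ} (h0 : 0 < x) : 1 - x ^ 3 < 1 := by
  linarith [pow_pos h0 3]

/-- Ramanujan's cubic transformation. -/
theorem cubic_transformation {x : ℝ} (h0 : 0 < x) (h1 : x ≤ 1) :
    3 * F (1 / 3) (2 / 3) (((1 - x) / (1 + 2 * x)) ^ 3) =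
      (1 + 2 * x) * F (1 / 3) (2 / 3) (1 - x ^ 3) := by
  have ha : (0 : ℝ) < 1 / 3 := by norm_num
  have hb : (0 : ℝ) < 2 / 3 := by norm_num
  obtain ⟨V, hV⟩ := exists_deriv_hypergeometric ha hb (by norm_num)
  have hBpos := B_pos ha hb
  set U : ℝ → ℝ := fun t => B (1 / 3) (2 / 3) * F (1 / 3) (2 / 3) t with hU
  set K : ℝ → ℝ := fun t => t * (1 - t) * V t with hK
  have hUpos : ∀ t, 0 ≤ t → t < 1 → 0 < U t := fun t h h' => mul_pos hBpos (F_pos ha hb h h')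
  set y : ℝ → ℝ := fun x => ((1 - x) / (1 + 2 * x)) ^ 3 with hy
  set z : ℝ → ℝ := fun x => 1 - x ^ 3 with hz
  have hy1 : ∀ u, 0 < u → u ≤ 1 → |y u| < 1 := fun u h h' =>
    abs_lt.2 ⟨by linarith [cubicArg_nonneg h h'], cubicArg_lt_one h h'⟩
  have hz1 : ∀ u, 0 < u → u ≤ 1 → |z u| < 1 := fun u h h' =>
    abs_lt.2 ⟨by linarith [one_sub_cube_nonneg h h'], one_sub_cube_lt_one h⟩
  have dy : ∀ u : ℝ, 0 < u → HasDerivAt y (-9 * (1 - u) ^ 2 / (1 + 2 * u) ^ 4) u :=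
    fun u hu => hasDerivAt_cubicArg (by linarith)
  have dz : ∀ u : ℝ, HasDerivAt z (-(3 * u ^ 2)) u := fun u => by
    simpa using (hasDerivAt_pow 3 u).const_sub 1
  have dl : ∀ u : ℝ, HasDerivAt (fun x : ℝ => 1 + 2 * x) 2 u := fun u => by
    simpa using ((hasDerivAt_id u).const_mul 2).const_add 1
  have dUy : ∀ u, 0 < u → u ≤ 1 → HasDerivAt (fun x => U (y x))
      (V (y u) * (-9 * (1 - u) ^ 2 / (1 + 2 * u) ^ 4)) u :=
    fun u h h' => (hV (y u) (hy1 u h h')).1.comp u (dy u h)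
  have dUz : ∀ u, 0 < u → u ≤ 1 → HasDerivAt (fun x => U (z x)) (V (z u) * (-(3 * u ^ 2))) u :=
    fun u h h' => (hV (z u) (hz1 u h h')).1.comp u (dz u)
  have dKy : ∀ u, 0 < u → u ≤ 1 → HasDerivAt (fun x => K (y x))
      (1 / 3 * (2 / 3) * U (y u) * (-9 * (1 - u) ^ 2 / (1 + 2 * u) ^ 4)) u :=
    fun u h h' => (hV (y u) (hy1 u h h')).2.comp u (dy u h)
  have dKz : ∀ u, 0 < u → u ≤ 1 → HasDerivAt (fun x => K (z x))
      (1 / 3 * (2 / 3) * U (z u) * (-(3 * u ^ 2))) u :=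
    fun u h h' => (hV (z u) (hz1 u h h')).2.comp u (dz u)
  -- the Wronskian times the weight of the common self-adjoint equation
  set W : ℝ → ℝ := fun u => U (y u) *
    (2 / 3 * ((u - u ^ 4) / (1 + 2 * u) ^ 2) * U (z u) - K (z u) / (1 + 2 * u)) +
      K (y u) * ((1 + 2 * u) / 3 * U (z u)) with hW
  -- Put `f = U(y)`, `g = (1+2u)/3 * U(z)` and `p = (u-u^4)/(1+2u)^2`. Then `p f' = -K(y)`, the
  -- bracket in `W` is `p g'`, and `W = p (f g' - f' g)`. Writing it with `K` avoids second
  -- derivatives. Both functions satisfy `(p h')' = 2(1-u)^2/(1+2u)^4 * h`.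
  have dW : ∀ u, 0 < u → u ≤ 1 → HasDerivAt W 0 u := by
    intro u h h'
    have hl : (1 + 2 * u) ≠ 0 := by linarith
    have dp : HasDerivAt (fun u : ℝ => u - u ^ 4) (1 - 4 * u ^ 3) u := by
      exact ((hasDerivAt_id u).sub (hasDerivAt_pow 4 u)).congr_deriv (by norm_num)
    have dl2 : HasDerivAt (fun u : ℝ => (1 + 2 * u) ^ 2) (2 * (1 + 2 * u) * 2) u := by
      exact ((dl u).pow 2).congr_deriv (by norm_num)
    have D := ((dUy u h h').mul ((((dp.div dl2 (pow_ne_zero 2 hl)).const_mul (2 / 3)).mul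
      (dUz u h h')).sub ((dKz u h h').div (dl u) hl))).add
        ((dKy u h h').mul (((dl u).div_const 3).mul (dUz u h h')))
    refine D.congr_deriv ?_
    simp only [Pi.mul_apply, Pi.div_apply, Pi.sub_apply]
    have ey : K (y u) = y u * (1 - y u) * V (y u) := rfl
    have ez : K (z u) = z u * (1 - z u) * V (z u) := rfl
    have eyu : y u = ((1 - u) / (1 + 2 * u)) ^ 3 := rfl
    have ezu : z u = 1 - u ^ 3 := rfl
    rw [ey, ez]
    generalize V (y u) = vy
    generalize V (z u) = vz
    generalize U (y u) = uy
    generalize U (z u) = uz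
    rw [eyu, ezu]
    field_simp
    ring
  -- At `u = 1` both arguments are `0`, so `K` vanishes there, and so does `u - u^4`.
  have W1 : W 1 = 0 := by simp [hW, hy, hz, hK]
  have W0 : ∀ u, 0 < u → u ≤ 1 → W u = 0 := by
    intro u h h'
    have := constant_of_has_deriv_right_zero (f := W) (a := u) (b := 1)
      (fun v hv => (dW v (h.trans_le hv.1) hv.2).continuousAt.continuousWithinAt)
      (fun v hv => (dW v (h.trans_le hv.1) hv.2.le).hasDerivWithinAt) 1 ⟨h', le_rfl⟩
    rw [← this, W1]
  set ρ : ℝ → ℝ := fun u => (1 + 2 * u) / 3 * U (z u) / U (y u) with hρ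
  have dρ : ∀ u, 0 < u → u ≤ 1 → HasDerivAt ρ ((((2 / 3) * U (z u) + (1 + 2 * u) / 3 *
      (V (z u) * (-(3 * u ^ 2)))) * U (y u) - (1 + 2 * u) / 3 * U (z u) *
      (V (y u) * (-9 * (1 - u) ^ 2 / (1 + 2 * u) ^ 4))) / U (y u) ^ 2) u := fun u h h' =>
    (((dl u).div_const 3).mul (dUz u h h')).div (dUy u h h')
      (hUpos _ (cubicArg_nonneg h h') (cubicArg_lt_one h h')).ne'
  have dρ0 : ∀ u, 0 < u → u < 1 → HasDerivAt ρ 0 u := by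
    intro u h h'
    refine (dρ u h h'.le).congr_deriv ?_
    have hl : (1 + 2 * u) ≠ 0 := by linarith
    have hw := W0 u h h'.le
    have hp : (u - u ^ 4) / (1 + 2 * u) ^ 2 ≠ 0 := by
      refine div_ne_zero ?_ (pow_ne_zero 2 hl)
      have : u ^ 3 < 1 := pow_lt_one₀ h.le h' (by norm_num)
      have : 0 < u * (1 - u ^ 3) := mul_pos h (by linarith)
      nlinarith
    -- The numerator of `ρ'` times `p` is `W`. Since `p` vanishes at `1`, this needs `u < 1`; the
    -- endpoint is reached by continuity of `ρ`.
    refine div_eq_zero_iff.2 (Or.inl ((mul_eq_zero.1 (Eq.trans ?_ hw)).resolve_left hp))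
    have ey : K (y u) = y u * (1 - y u) * V (y u) := rfl
    have ez : K (z u) = z u * (1 - z u) * V (z u) := rfl
    have eyu : y u = ((1 - u) / (1 + 2 * u)) ^ 3 := rfl
    have ezu : z u = 1 - u ^ 3 := rfl
    simp only [hW]
    rw [ey, ez]
    generalize V (y u) = vy
    generalize V (z u) = vz
    generalize U (y u) = uy
    generalize U (z u) = uz
    rw [eyu, ezu]
    field_simp
    ring
  have hconst := constant_of_has_deriv_right_zero (f := ρ) (a := x) (b := 1)
    (fun v hv => (dρ v (h0.trans_le hv.1) hv.2).continuousAt.continuousWithinAt)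
    (fun v hv => (dρ0 v (h0.trans_le hv.1) hv.2).hasDerivWithinAt) 1 ⟨h1, le_rfl⟩
  have ρ1 : ρ 1 = 1 := by
    have : U 0 ≠ 0 := (hUpos 0 le_rfl one_pos).ne'
    norm_num [hρ, hy, hz, this]
  rw [ρ1] at hconst
  have hne := (hUpos _ (cubicArg_nonneg h0 h1) (cubicArg_lt_one h0 h1)).ne'
  have := (eq_div_iff hne).1 hconst
  simp only [hU] at this
  have h3 := mul_left_cancel₀ hBpos.ne' (a := B (1 / 3) (2 / 3))
    (b := 3 * F (1 / 3) (2 / 3) (((1 - x) / (1 + 2 * x)) ^ 3))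
    (c := (1 + 2 * x) * F (1 / 3) (2 / 3) (1 - x ^ 3))
  exact h3 (by linear_combination 3 * this)

/-! ### Comparison of series with monotone coefficient quotient -/

/-- With `φ = p/q`, the series `∑ (c n - φ d n) t^n` vanishes at `y`, and its coefficients change
sign at most once, from nonnegative to negative. If `m` is the first negative index, replacing `y^n`
by `z^n` instead of `y^n (z/y)^m` lowers every term, so the value at `z` is at most `0`. -/
lemma tsum_mul_pow_ratio_anti {c d : ℕ → ℝ} {y z p q p' q' : ℝ} (hd : ∀ n, 0 < d n)
    (hanti : Antitone fun n => c n / d n) (hy : 0 < y) (hyz : y ≤ z)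
    (hp : HasSum (fun n => c n * y ^ n) p) (hq : HasSum (fun n => d n * y ^ n) q)
    (hp' : HasSum (fun n => c n * z ^ n) p') (hq' : HasSum (fun n => d n * z ^ n) q') :
    p' * q ≤ p * q' := by
  have hq0 : 0 < q := by
    have := le_hasSum hq 0 fun n _ => mul_nonneg (hd n).le (pow_nonneg hy.le n)
    exact (by simpa using hd 0 : (0 : ℝ) < d 0 * y ^ 0).trans_le this
  set φ := p / q with hφ
  have hpφ : p = φ * q := by rw [hφ, div_mul_cancel₀ _ hq0.ne']
  have h0 : HasSum (fun n => (c n - φ * d n) * y ^ n) 0 := by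
    have := hp.sub (hq.mul_left φ)
    rw [← hpφ, sub_self] at this
    refine this.congr_fun ?_
    intro n
    ring
  have h1 : HasSum (fun n => (c n - φ * d n) * z ^ n) (p' - φ * q') := by
    refine (hp'.sub (hq'.mul_left φ)).congr_fun ?_
    intro n
    ring
  suffices h : p' - φ * q' ≤ 0 by
    rw [hpφ]
    nlinarith
  by_cases hN : ∃ n, c n / d n < φ
  · obtain ⟨N, hN⟩ := hN
    classical
    have hex : ∃ n, c n / d n < φ := ⟨N, hN⟩
    set m := Nat.find hex with hm
    have hterm : ∀ n, (c n - φ * d n) * z ^ n ≤ (c n - φ * d n) * y ^ n * (z / y) ^ m := by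
      intro n
      have hzy : 1 ≤ z / y := (one_le_div hy).2 hyz
      have e : z ^ n = y ^ n * (z / y) ^ n := by rw [← mul_pow, mul_div_cancel₀ _ hy.ne']
      rw [e, ← mul_assoc]
      rcases lt_or_ge n m with h | h
      · have h2 := not_lt.1 (Nat.find_min hex h)
        rw [le_div_iff₀ (hd n)] at h2
        exact mul_le_mul_of_nonneg_left (pow_le_pow_right₀ hzy h.le)
          (mul_nonneg (by linarith) (pow_nonneg hy.le n))
      · have h2 : c n / d n < φ := (hanti h).trans_lt (Nat.find_spec hex)
        rw [div_lt_iff₀ (hd n)] at h2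
        exact mul_le_mul_of_nonpos_left (pow_le_pow_right₀ hzy h)
          (mul_nonpos_of_nonpos_of_nonneg (by linarith) (pow_nonneg hy.le n))
    have := hasSum_le hterm h1 (h0.mul_right _)
    rwa [zero_mul] at this
  -- Without a sign change all terms are nonnegative with sum `0`, so every coefficient vanishes.
  · push Not at hN
    have hnn : ∀ n, 0 ≤ (c n - φ * d n) * y ^ n := fun n => by
      have := hN n
      rw [le_div_iff₀ (hd n)] at this
      exact mul_nonneg (by linarith) (pow_nonneg hy.le n)
    have hz := (hasSum_zero_iff_of_nonneg hnn).1 h0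
    have hz' : (fun n => (c n - φ * d n) * z ^ n) = fun _ => 0 := by
      funext n
      have := congrFun hz n
      simp only [Pi.zero_apply, mul_eq_zero, pow_eq_zero_iff', hy.ne', false_and, or_false] at this
      rw [this, zero_mul]
    rw [hz'] at h1
    exact (h1.unique hasSum_zero).le

section Comparison

variable {a b a' b' : ℝ}

lemma tendsto_betaCoeff_div (ha : 0 < a) (hb : 0 < b) (ha' : 0 < a') (hb' : 0 < b') :
    Tendsto (fun n => betaCoeff a b n / betaCoeff a' b' n) atTop (𝓝 1) := by
  have h := (tendsto_nat_mul_betaCoeff ha hb).div (tendsto_nat_mul_betaCoeff ha' hb') one_ne_zero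
  rw [div_one] at h
  refine h.congr' ?_
  filter_upwards [eventually_gt_atTop 0] with n hn
  have hn' : (n : ℝ) ≠ 0 := by exact_mod_cast hn.ne'
  simp only [Pi.div_apply]
  exact mul_div_mul_left _ _ hn'

/-- The coefficient quotient of two zero-balanced hypergeometric series decreases when the cubic
polynomials in the consecutive quotients are ordered. -/
lemma antitone_betaCoeff_div (ha : 0 < a) (hb : 0 < b) (ha' : 0 < a') (hb' : 0 < b')
    (h : ∀ n : ℕ, (a + n) * (b + n) * (a' + b' + n) ≤ (a' + n) * (b' + n) * (a + b + n)) :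
    Antitone fun n => betaCoeff a b n / betaCoeff a' b' n := by
  refine antitone_nat_of_succ_le fun n => ?_
  have h1 : 0 < a + b + n := by positivity
  have h2 : 0 < a' + b' + n := by positivity
  have h3 : (0 : ℝ) < n + 1 := by positivity
  have e1 := betaCoeff_succ ha hb n
  have e2 := betaCoeff_succ ha' hb' n
  rw [← eq_div_iff (by positivity)] at e1 e2
  have p1 := betaCoeff_pos ha hb n
  have p2 := betaCoeff_pos ha' hb' n
  rw [e1, e2]
  have e : betaCoeff a b n * ((a + n) * (b + n)) / ((a + b + n) * (n + 1)) /
      (betaCoeff a' b' n * ((a' + n) * (b' + n)) / ((a' + b' + n) * (n + 1))) =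
      betaCoeff a b n / betaCoeff a' b' n * ((a + n) * (b + n) * (a' + b' + n) /
        ((a' + n) * (b' + n) * (a + b + n))) := by
    have h4 : 0 < a' + n := by positivity
    have h5 : 0 < b' + n := by positivity
    field_simp
  rw [e]
  refine mul_le_of_le_one_right (by positivity) ?_
  rw [div_le_one (by positivity)]
  exact h n

variable (ha : 0 < a) (hb : 0 < b) (ha' : 0 < a') (hb' : 0 < b')
  (hanti : Antitone fun n => betaCoeff a b n / betaCoeff a' b' n)
include ha hb ha' hb' hanti

/-- A decreasing quotient stays above its limit, which is `1`. -/
lemma betaCoeff_le_of_antitone (n : ℕ) : betaCoeff a' b' n ≤ betaCoeff a b n := by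
  have := hanti.le_of_tendsto (tendsto_betaCoeff_div ha hb ha' hb') n
  exact (one_le_div (betaCoeff_pos ha' hb' n)).1 this

lemma F_mul_F_le_of_antitone {y z : ℝ} (hy : 0 < y) (hyz : y ≤ z) (hz : z < 1) :
    F a b z * F a' b' y ≤ F a b y * F a' b' z := by
  have hy1 : |y| < 1 := abs_lt.2 ⟨by linarith, by linarith⟩
  have hz1 : |z| < 1 := abs_lt.2 ⟨by linarith, hz⟩
  have h := tsum_mul_pow_ratio_anti (betaCoeff_pos ha' hb') hanti hy hyz
    (hasSum_betaCoeff ha hb hy1) (hasSum_betaCoeff ha' hb' hy1)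
    (hasSum_betaCoeff ha hb hz1) (hasSum_betaCoeff ha' hb' hz1)
  have hB := mul_pos (B_pos ha hb) (B_pos ha' hb')
  exact le_of_mul_le_mul_left (by linarith) hB

lemma F_le_F_of_antitone {x : ℝ} (h0 : 0 ≤ x) (h1 : x < 1) : F a b x ≤ F a' b' x := by
  have hx : |x| < 1 := abs_lt.2 ⟨by linarith, h1⟩
  have hB := B_pos ha hb
  have hB' := B_pos ha' hb'
  have h := hasSum_le (fun n => ?_) (hasSum_betaCoeff ha hb hx)
    ((hasSum_betaCoeff ha' hb' hx).mul_left (B a b / B a' b'))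
  · rw [← mul_assoc, div_mul_cancel₀ _ hB'.ne'] at h
    exact le_of_mul_le_mul_left h hB
  · have := hanti (Nat.zero_le n)
    simp only [betaCoeff_zero] at this
    rw [div_le_iff₀ (betaCoeff_pos ha' hb' n)] at this
    rw [← mul_assoc]
    exact mul_le_mul_of_nonneg_right this (pow_nonneg h0 n)

lemma BF_sub_BF_mono_of_antitone {y z : ℝ} (h0 : 0 ≤ y) (hyz : y ≤ z) (hz : z < 1) :
    B a b * F a b y - B a' b' * F a' b' y ≤ B a b * F a b z - B a' b' * F a' b' z := by
  have hy1 : |y| < 1 := abs_lt.2 ⟨by linarith, by linarith⟩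
  have hz1 : |z| < 1 := abs_lt.2 ⟨by linarith, hz⟩
  refine hasSum_le (fun n => ?_)
    ((hasSum_betaCoeff ha hb hy1).sub (hasSum_betaCoeff ha' hb' hy1))
    ((hasSum_betaCoeff ha hb hz1).sub (hasSum_betaCoeff ha' hb' hz1))
  rw [← sub_mul, ← sub_mul]
  exact mul_le_mul_of_nonneg_left (pow_le_pow_left₀ h0 hyz n)
    (sub_nonneg.2 (betaCoeff_le_of_antitone ha hb ha' hb' hanti n))

lemma BF_le_BF_of_antitone {x : ℝ} (h0 : 0 ≤ x) (h1 : x < 1) :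
    B a' b' * F a' b' x ≤ B a b * F a b x := by
  have hx : |x| < 1 := abs_lt.2 ⟨by linarith, h1⟩
  exact hasSum_le (fun n => mul_le_mul_of_nonneg_right
    (betaCoeff_le_of_antitone ha hb ha' hb' hanti n) (pow_nonneg h0 n))
    (hasSum_betaCoeff ha' hb' hx) (hasSum_betaCoeff ha hb hx)

/-- Bounding `x^n` by `1` in the partial sums leaves the sum of the coefficient differences, in
which the logarithms cancel. -/
lemma BF_sub_BF_le_of_antitone {x : ℝ} (h0 : 0 ≤ x) (h1 : x < 1) :
    B a b * F a b x - B a' b' * F a' b' x ≤ R a b - R a' b' := by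
  have hx : |x| < 1 := abs_lt.2 ⟨by linarith, h1⟩
  refine le_of_tendsto_of_tendsto'
    ((hasSum_betaCoeff ha hb hx).sub (hasSum_betaCoeff ha' hb' hx)).tendsto_sum_nat
    (tendsto_sum_betaCoeff_sub ha hb ha' hb') fun N => Finset.sum_le_sum fun n _ => ?_
  rw [← sub_mul]
  exact mul_le_of_le_one_right
    (sub_nonneg.2 (betaCoeff_le_of_antitone ha hb ha' hb' hanti n)) (pow_le_one₀ h0 h1.le)

end Comparison

/-! ### The constants, the parameter regions and the resulting bounds -/

lemma cubicArg_le_one_sub_cube {x : ℝ} (h0 : 0 < x) (h1 : x < 1) :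
    ((1 - x) / (1 + 2 * x)) ^ 3 ≤ 1 - x ^ 3 := by
  have h2 : (1 - x) / (1 + 2 * x) ≤ 1 - x := div_le_self (by linarith) (by linarith)
  have h3 : 0 ≤ (1 - x) / (1 + 2 * x) := div_nonneg (by linarith) (by linarith)
  refine (pow_le_pow_left₀ h3 h2 3).trans ?_
  nlinarith [mul_pos h0 (sub_pos.2 h1)]

lemma B_one_third_two_thirds : Real.sqrt 3 * B (1 / 3) (2 / 3) = 2 * Real.pi := by
  have h := Real.Gamma_mul_Gamma_one_sub (1 / 3)
  rw [show (1 : ℝ) - 1 / 3 = 2 / 3 by norm_num, show Real.pi * (1 / 3) = Real.pi / 3 by ring,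
    Real.sin_pi_div_three] at h
  rw [B, ProbabilityTheory.beta, h]
  norm_num
  have : Real.sqrt 3 ≠ 0 := by positivity
  field_simp

lemma sqrt_three_mul_div_six_pi (β : ℝ) :
    Real.sqrt 3 * β / (6 * Real.pi) = β / (3 * B (1 / 3) (2 / 3)) := by
  have hB : 0 < B (1 / 3) (2 / 3) := B_pos (by norm_num) (by norm_num)
  have hpi := Real.pi_pos
  rw [div_eq_div_iff (by positivity) (by positivity)]
  linear_combination 3 * β * B_one_third_two_thirds

/-- In the difference of the two cubics in `n` the terms in `n^3` and `n^2` cancel; the conditions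
defining `D1` are exactly the signs of the two remaining coefficients. -/
lemma antitone_betaCoeff_div_of_mem_D1 {a b : ℝ} (h : (a, b) ∈ D1) :
    Antitone fun n => betaCoeff a b n / betaCoeff (1 / 3) (2 / 3) n := by
  obtain ⟨ha, hb, h1, h2⟩ := h
  simp only at ha hb h1 h2
  refine antitone_betaCoeff_div ha hb (by norm_num) (by norm_num) fun n => ?_
  have := mul_nonneg (sub_nonneg.2 h1) n.cast_nonneg (α := ℝ)
  linarith

lemma antitone_betaCoeff_div_of_mem_D3 {a b : ℝ} (h : (a, b) ∈ D3) :
    Antitone fun n => betaCoeff (1 / 3) (2 / 3) n / betaCoeff a b n := by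
  obtain ⟨ha, hb, h1, h2⟩ := h
  simp only at ha hb h1 h2
  refine antitone_betaCoeff_div (by norm_num) (by norm_num) ha hb fun n => ?_
  have := mul_nonneg (sub_nonneg.2 h1) n.cast_nonneg (α := ℝ)
  linarith

lemma D5_subset_D1 : D5 ⊆ D1 := by
  rintro ⟨a, b⟩ ⟨ha, hb, h1, h2⟩
  exact ⟨ha, hb, by simp only at h1 h2 ⊢; linarith, h2⟩

lemma D6_subset_D3 : D6 ⊆ D3 := by
  rintro ⟨a, b⟩ ⟨ha, hb, h1, h2⟩
  exact ⟨ha, hb, by simp only at h1 h2 ⊢; linarith, h2⟩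

section Bounds

variable {a b x : ℝ} (hx : x ∈ Set.Ioo (0 : ℝ) 1)
include hx

/-- `F/F₀` is no larger at `z` than at `y`, and `F₀` satisfies the relation with equality. -/
lemma le_three_mul_F_of_mem_D1 (h : (a, b) ∈ D1) :
    (1 + 2 * x) * F a b (1 - x ^ 3) ≤ 3 * F a b (((1 - x) / (1 + 2 * x)) ^ 3) := by
  have hy : 0 < ((1 - x) / (1 + 2 * x)) ^ 3 :=
    pow_pos (div_pos (by linarith [hx.2]) (by linarith [hx.1])) 3
  have hz := one_sub_cube_lt_one hx.1
  have hm := F_mul_F_le_of_antitone h.1 h.2.1 (by norm_num) (by norm_num)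
    (antitone_betaCoeff_div_of_mem_D1 h) hy (cubicArg_le_one_sub_cube hx.1 hx.2) hz
  have hF : 0 < F (1 / 3) (2 / 3) (1 - x ^ 3) :=
    F_pos (by norm_num) (by norm_num) (one_sub_cube_nonneg hx.1 hx.2.le) hz
  refine le_of_mul_le_mul_right ?_ hF
  linear_combination 3 * hm - F a b (1 - x ^ 3) * cubic_transformation hx.1 hx.2.le

lemma three_mul_F_le_of_mem_D3 (h : (a, b) ∈ D3) :
    3 * F a b (((1 - x) / (1 + 2 * x)) ^ 3) ≤ (1 + 2 * x) * F a b (1 - x ^ 3) := by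
  have hy : 0 < ((1 - x) / (1 + 2 * x)) ^ 3 :=
    pow_pos (div_pos (by linarith [hx.2]) (by linarith [hx.1])) 3
  have hz := one_sub_cube_lt_one hx.1
  have hm := F_mul_F_le_of_antitone (by norm_num) (by norm_num) h.1 h.2.1
    (antitone_betaCoeff_div_of_mem_D3 h) hy (cubicArg_le_one_sub_cube hx.1 hx.2) hz
  have hF : 0 < F (1 / 3) (2 / 3) (1 - x ^ 3) :=
    F_pos (by norm_num) (by norm_num) (one_sub_cube_nonneg hx.1 hx.2.le) hz
  refine le_of_mul_le_mul_right ?_ hF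
  linear_combination 3 * hm + F a b (1 - x ^ 3) * cubic_transformation hx.1 hx.2.le

lemma three_mul_BF_sub_le_of_antitone {a' b' : ℝ} (ha : 0 < a) (hb : 0 < b) (ha' : 0 < a')
    (hb' : 0 < b') (hanti : Antitone fun n => betaCoeff a b n / betaCoeff a' b' n) :
    3 * (B a b * F a b (((1 - x) / (1 + 2 * x)) ^ 3) -
        B a' b' * F a' b' (((1 - x) / (1 + 2 * x)) ^ 3)) -
      (1 + 2 * x) * (B a b * F a b (1 - x ^ 3) - B a' b' * F a' b' (1 - x ^ 3)) ≤
      2 * (1 + 2 * x) * (R a b - R a' b') := by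
  have hz0 := one_sub_cube_nonneg hx.1 hx.2.le
  have hz := one_sub_cube_lt_one hx.1
  have h1 := BF_sub_BF_mono_of_antitone ha hb ha' hb' hanti (cubicArg_nonneg hx.1 hx.2.le)
    (cubicArg_le_one_sub_cube hx.1 hx.2) hz
  have h2 := BF_le_BF_of_antitone ha hb ha' hb' hanti hz0 hz
  have h3 := BF_sub_BF_le_of_antitone ha hb ha' hb' hanti hz0 hz
  have h4 := mul_le_mul_of_nonneg_left h3 (by linarith [hx.1] : 0 ≤ 2 * (1 + 2 * x))
  have h5 := mul_nonneg (sub_nonneg.2 h2) hx.1.le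
  -- For the difference `D = B F - B' F'` this reads `3 D(y) - (1+2x) D(z) ≤ 2(1-x) D(z) ≤ 2(1+2x)
  -- D(z)`, followed by the bound on `D(z)`.
  linarith

end Bounds

end CubicTransformation

/-! ### The four inequalities -/

open CubicTransformation in
theorem theorem2p5 :
    (∀ a b : ℝ, (a, b) ∈ CubicTransformation.D1 → ∀ x ∈ Set.Ioo (0 : ℝ) 1,
      1 / 3 ≤ CubicTransformation.F a b (((1 - x) / (1 + 2 * x)) ^ 3) /
          ((1 + 2 * x) * CubicTransformation.F a b (1 - x ^ 3)) ∧
      CubicTransformation.F a b (((1 - x) / (1 + 2 * x)) ^ 3) /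
          ((1 + 2 * x) * CubicTransformation.F a b (1 - x ^ 3)) ≤
        Real.sqrt 3 * CubicTransformation.B a b / (6 * Real.pi)) ∧
    (∀ a b : ℝ, (a, b) ∈ CubicTransformation.D3 → ∀ x ∈ Set.Ioo (0 : ℝ) 1,
      Real.sqrt 3 * CubicTransformation.B a b / (6 * Real.pi) ≤
        CubicTransformation.F a b (((1 - x) / (1 + 2 * x)) ^ 3) /
          ((1 + 2 * x) * CubicTransformation.F a b (1 - x ^ 3)) ∧
      CubicTransformation.F a b (((1 - x) / (1 + 2 * x)) ^ 3) /
          ((1 + 2 * x) * CubicTransformation.F a b (1 - x ^ 3)) ≤ 1 / 3) ∧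
    (∀ a b : ℝ, (a, b) ∈ CubicTransformation.D5 → ∀ x ∈ Set.Ioo (0 : ℝ) 1,
      (1 + 2 * x) * CubicTransformation.F a b (1 - x ^ 3) ≤
        3 * CubicTransformation.F a b (((1 - x) / (1 + 2 * x)) ^ 3) ∧
      3 * CubicTransformation.F a b (((1 - x) / (1 + 2 * x)) ^ 3) ≤
        (1 + 2 * x) * (CubicTransformation.F a b (1 - x ^ 3) +
          2 * (CubicTransformation.R a b - Real.log 27) / CubicTransformation.B a b)) ∧
    (∀ a b : ℝ, (a, b) ∈ CubicTransformation.D6 → ∀ x ∈ Set.Ioo (0 : ℝ) 1,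
      0 ≤ (1 + 2 * x) * CubicTransformation.F a b (1 - x ^ 3) -
        3 * CubicTransformation.F a b (((1 - x) / (1 + 2 * x)) ^ 3) ∧
      (1 + 2 * x) * CubicTransformation.F a b (1 - x ^ 3) -
          3 * CubicTransformation.F a b (((1 - x) / (1 + 2 * x)) ^ 3) ≤
        2 * (1 + 2 * x) * (Real.log 27 - CubicTransformation.R a b) /
          CubicTransformation.B a b) := by
  have ha₀ : (0 : ℝ) < 1 / 3 := by norm_num
  have hb₀ : (0 : ℝ) < 2 / 3 := by norm_num
  have hB₀ := B_pos ha₀ hb₀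
  refine ⟨fun a b h x hx => ?_, fun a b h x hx => ?_, fun a b h x hx => ?_, fun a b h x hx => ?_⟩
  · have hl : 0 < 1 + 2 * x := by linarith [hx.1]
    have hz0 := one_sub_cube_nonneg hx.1 hx.2.le
    have hz := one_sub_cube_lt_one hx.1
    have hanti := antitone_betaCoeff_div_of_mem_D1 h
    have hB := B_pos h.1 h.2.1
    have hF := F_pos h.1 h.2.1 hz0 hz
    have hlow := le_three_mul_F_of_mem_D1 hx h
    have h1 := F_le_F_of_antitone h.1 h.2.1 ha₀ hb₀ hanti (cubicArg_nonneg hx.1 hx.2.le)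
      (cubicArg_lt_one hx.1 hx.2.le)
    have h2 := BF_le_BF_of_antitone h.1 h.2.1 ha₀ hb₀ hanti hz0 hz
    have hT := cubic_transformation hx.1 hx.2.le
    rw [sqrt_three_mul_div_six_pi, div_le_div_iff₀ (by norm_num) (by positivity),
      div_le_div_iff₀ (by positivity) (by positivity)]
    refine ⟨by linarith, ?_⟩
    have h3 := mul_le_mul_of_nonneg_left h1 (by positivity : 0 ≤ 3 * B (1 / 3) (2 / 3))
    have h4 := mul_le_mul_of_nonneg_left h2 hl.le
    linear_combination h3 + h4 + B (1 / 3) (2 / 3) * hT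
  · have hl : 0 < 1 + 2 * x := by linarith [hx.1]
    have hz0 := one_sub_cube_nonneg hx.1 hx.2.le
    have hz := one_sub_cube_lt_one hx.1
    have hanti := antitone_betaCoeff_div_of_mem_D3 h
    have hF := F_pos h.1 h.2.1 hz0 hz
    have hup := three_mul_F_le_of_mem_D3 hx h
    have h1 := F_le_F_of_antitone ha₀ hb₀ h.1 h.2.1 hanti (cubicArg_nonneg hx.1 hx.2.le)
      (cubicArg_lt_one hx.1 hx.2.le)
    have h2 := BF_le_BF_of_antitone ha₀ hb₀ h.1 h.2.1 hanti hz0 hz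
    have hT := cubic_transformation hx.1 hx.2.le
    rw [sqrt_three_mul_div_six_pi, div_le_div_iff₀ (by positivity) (by positivity),
      div_le_div_iff₀ (by positivity) (by norm_num)]
    refine ⟨?_, by linarith⟩
    have h3 := mul_le_mul_of_nonneg_left h1 (by positivity : 0 ≤ 3 * B (1 / 3) (2 / 3))
    have h4 := mul_le_mul_of_nonneg_left h2 hl.le
    linear_combination h3 + h4 - B (1 / 3) (2 / 3) * hT
  · have h' := D5_subset_D1 h
    have hB := B_pos h.1 h.2.1
    refine ⟨le_three_mul_F_of_mem_D1 hx h', ?_⟩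
    have hb := three_mul_BF_sub_le_of_antitone hx h'.1 h'.2.1 ha₀ hb₀
      (antitone_betaCoeff_div_of_mem_D1 h')
    rw [R_one_third_two_thirds] at hb
    refine le_of_mul_le_mul_left ?_ hB
    have e : B a b * ((1 + 2 * x) * (F a b (1 - x ^ 3) + 2 * (R a b - Real.log 27) / B a b)) =
        (1 + 2 * x) * (B a b * F a b (1 - x ^ 3)) +
          2 * (1 + 2 * x) * (R a b - Real.log 27) := by
      field_simp
    rw [e]
    -- The contributions of `F₀` to `hb` cancel by the cubic transformation.
    linear_combination hb + B (1 / 3) (2 / 3) * cubic_transformation hx.1 hx.2.le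
  · have h' := D6_subset_D3 h
    have hB := B_pos h.1 h.2.1
    refine ⟨sub_nonneg.2 (three_mul_F_le_of_mem_D3 hx h'), ?_⟩
    have hb := three_mul_BF_sub_le_of_antitone hx ha₀ hb₀ h'.1 h'.2.1
      (antitone_betaCoeff_div_of_mem_D3 h')
    rw [R_one_third_two_thirds] at hb
    rw [le_div_iff₀ hB]
    linear_combination hb - B (1 / 3) (2 / 3) * cubic_transformation hx.1 hx.2.le
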